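/- All transfer matrices are proper and real rational; $\mathcal{RH}_\infty$ denotes the stable ones (all poles in the open left half-plane). A feedback loop $a=Cb+r_1$, $b=Pa+r_2$ of $P$ and $C$ is internally stable if it is uniquely solvable and the transfer matrix from $(r_1,r_2)$ to $(a,b)$ is in $\mathcal{RH}_\infty$; then $C$ is called a stabilizing controller for $P$. Let $G:(v,d,u)\mapsto(w,z,y)$ be a subsystem with blocks $G_{wv},G_{wd},\dots,G_{yu}$, interconnected with an environment $v=\overline Gw$ and a controller $u=Ky$. An environment $\overline G$ is admissible for $G$ if the interconnection of $G$ and $\overline G$ without controller ($u$ free) is internally stable. $K$ is a retrofit controller if the interconnection of $G$, $\overline G$ and $K$ is internally stable for every admissible $\overline G$. A retrofit controller $K$ is output-rectifying if $K=(I+QG_{yu})^{-1}Q$ for some $Q\in\mathcal{RH}_\infty$ with $I+QG_{yu}$ invertible and $QG_{yv}=0$. Assume that $G\in\mathcal{RH}_\infty$ and that $v$ and $w$ are measured in addition to $y$, i.e. in the definitions of retrofit and output-rectifying retrofit controllers $y$ is replaced by $(y,w,v)$, so that $u=K\,(y,w,v)$, $G_{yv}$ is replaced by $\begin{bmatrix}G_{yv}\\G_{wv}\\I\end{bmatrix}$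 and $G_{yu}$ by $\begin{bmatrix}G_{yu}\\G_{wu}\\0\end{bmatrix}$. Let $\overline G_{\rm apx}$ (an approximate environment model) be admissible for $G$, and put $$G^+:=G+G_{(w,z,y)v}\overline G_{\rm apx}(I-G_{wv}\overline G_{\rm apx})^{-1}G_{w(v,d,u)},$$ $$R:=\begin{bmatrix}I&0&-G_{yv}\\0&I&-G_{wv}\end{bmatrix},\qquad X:=\begin{bmatrix}I&G_{yv}\overline G_{\rm apx}(I-G_{wv}\overline G_{\rm apx})^{-1}\\0&(I-G_{wv}\overline G_{\rm apx})^{-1}\end{bmatrix}.$$ Then the following hold. 1. $X\in\mathcal{RH}_\infty$, and $X$ is invertible as a rational matrix; if $\overline G_{\rm apx}$ is stable, then $X^{-1}\in\mathcal{RH}_\infty$. 2. If $\hat K$ is a stabilizing controller for $G^+_{(y,w)u}$, then $K=\hat KXR$ is an output-rectifying retrofit controller. 3. If $X^{-1}\in\mathcal{RH}_\infty$ (in particular, if $\overline G_{\rm apx}$ is stable), then $K$ is an output-rectifying retrofit controller if and only if $K=\hat KXR$ for some stabilizing controller $\hat K$ for $G^+_{(y,w)u}$. 4. Let $\hat K$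 be a stabilizing controller for $G^+_{(y,w)u}$, let $K=\hat KXR$, and let $\overline G$ be any environment with $I-G_{wv}\overline G$ invertible (in particular, any admissible one). Then the equations of the interconnection of $G$, $\overline G$ and $K$ are uniquely solvable, and with $\Delta:=\overline G-\overline G_{\rm apx}$ its transfer matrix $T_{zd}:d\mapsto z$ is $$T_{zd}=\hat T^+_{zd}(\hat K)+G_{zv}(I-\overline GG_{wv})^{-1}\Delta\,\hat T^+_{wd}(\hat K),$$ where, for $a\in\{z,w\}$, $$\hat T^+_{ad}(\hat K):=G^+_{ad}+G^+_{au}\hat K(I-G^+_{(y,w)u}\hat K)^{-1}G^+_{(y,w)d}.$$ -/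

import Mathlib

open Matrix

noncomputable section

namespace RetrofitControl

/-- Scalar real rational transfer functions in the Laplace variable. -/
abbrev TF : Type := RatFunc ℝ

/-- A real rational function is proper: it stays bounded at infinity. -/
def IsProperTF (f : TF) : Prop := f.num.degree ≤ f.denom.degree

/-- All poles (roots of the reduced denominator) lie in the open left half plane. -/
def IsStableTF (f : TF) : Prop :=
  ∀ s : ℂ, Polynomial.aeval s f.denom = 0 → s.re < 0

/-- A proper real rational transfer matrix. -/
def IsProper {m n : Type*} (M : Matrix m n TF) : Prop := ∀ i j, IsProperTF (M i j)

/-- Membership in `RH∞`: stable, proper, real rational transfer matrices. -/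
def IsRHInf {m n : Type*} (M : Matrix m n TF) : Prop :=
  ∀ i j, IsProperTF (M i j) ∧ IsStableTF (M i j)

/-- Internal stability of the (positive) feedback loop `a = C b + r₁`, `b = P a + r₂`:
the loop equations are uniquely solvable, and the four transfer matrices from the injected
signals `(r₁, r₂)` to the internal signals `(a, b)` are stable and proper. -/
def InternallyStable {p q : Type*} [Fintype p] [DecidableEq p] [Fintype q] [DecidableEq q]
    (P : Matrix p q TF) (C : Matrix q p TF) : Prop :=
  IsUnit (fromBlocks 1 (-C) (-P) 1 : Matrix (q ⊕ p) (q ⊕ p) TF) ∧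
    IsRHInf (fromBlocks 1 (-C) (-P) 1 : Matrix (q ⊕ p) (q ⊕ p) TF)⁻¹

/-- `C` is a (proper) stabilizing controller for `P`. -/
def IsStabilizing {p q : Type*} [Fintype p] [DecidableEq p] [Fintype q] [DecidableEq q]
    (P : Matrix p q TF) (C : Matrix q p TF) : Prop :=
  IsProper C ∧ InternallyStable P C

/-- A subsystem `(v, d, u) ↦ (w, z, y)`, given by its nine transfer matrices.
The six type parameters index the components of the signals `w, z, y` and `v, d, u`. -/
structure Subsystem (W Z Y V D U : Type*) where
  wv : Matrix W V TF
  wd : Matrix W D TF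
  wu : Matrix W U TF
  zv : Matrix Z V TF
  zd : Matrix Z D TF
  zu : Matrix Z U TF
  yv : Matrix Y V TF
  yd : Matrix Y D TF
  yu : Matrix Y U TF

namespace Subsystem

variable {W Z Y V D U : Type*}

/-- The whole transfer matrix of the subsystem. -/
def toMatrix (G : Subsystem W Z Y V D U) : Matrix (W ⊕ (Z ⊕ Y)) (V ⊕ (D ⊕ U)) TF :=
  fromBlocks G.wv (fromCols G.wd G.wu) (fromRows G.zv G.yv)
    (fromBlocks G.zd G.zu G.yd G.yu)

/-- The feedback laws closed around the subsystem: `v = E w` and `u = K y`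
(`d` is a free external input, `z` a free external output). The argument `_G` only fixes the
index types. -/
def link (_G : Subsystem W Z Y V D U) (E : Matrix V W TF) (K : Matrix U Y TF) :
    Matrix (V ⊕ (D ⊕ U)) (W ⊕ (Z ⊕ Y)) TF :=
  fromBlocks E 0 0 (fromBlocks 0 0 0 K)

variable [Fintype W] [DecidableEq W] [Fintype Z] [DecidableEq Z] [Fintype Y] [DecidableEq Y]
  [Fintype V] [DecidableEq V] [Fintype D] [DecidableEq D] [Fintype U] [DecidableEq U]

/-- Admissible environments: the (proper) environments `E` for which the preexisting system,
i.e. the interconnection of `G` with `v = E w` and without controller, is internally stable. -/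
def IsAdmissible (G : Subsystem W Z Y V D U) (E : Matrix V W TF) : Prop :=
  IsProper E ∧ InternallyStable G.toMatrix (G.link E 0)

/-- Retrofit controllers: the (proper) controllers `u = K y` for which the resultant control
system is internally stable for every admissible environment. -/
def IsRetrofit (G : Subsystem W Z Y V D U) (K : Matrix U Y TF) : Prop :=
  IsProper K ∧ ∀ E : Matrix V W TF, G.IsAdmissible E → InternallyStable G.toMatrix (G.link E K)

/-- Output-rectifying retrofit controllers (for a stable subsystem): retrofit controllers with a
Youla parameter `Q` such that `Q G_{yv} = 0`. -/
def IsOutputRectifying (G : Subsystem W Z Y V D U) (K : Matrix U Y TF) : Prop :=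
  G.IsRetrofit K ∧ ∃ Q : Matrix U Y TF, IsRHInf Q ∧ IsUnit (1 + Q * G.yu) ∧
    K = (1 + Q * G.yu)⁻¹ * Q ∧ Q * G.yv = 0

/-- The transfer matrix `d ↦ z` of the interconnection of `G` with `v = E w` and `u = K y`. -/
def closedLoop (G : Subsystem W Z Y V D U) (E : Matrix V W TF) (K : Matrix U Y TF) :
    Matrix Z D TF :=
  ((1 - G.toMatrix * G.link E K)⁻¹ * G.toMatrix).submatrix
    (fun i => Sum.inr (Sum.inl i)) (fun j => Sum.inr (Sum.inl j))

/-- The subsystem in which the interconnection signals `w` and `v` are measured in addition to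
`y`: the measurement output is `(y, w, v)`. -/
def measured (G : Subsystem W Z Y V D U) : Subsystem W Z (Y ⊕ (W ⊕ V)) V D U where
  wv := G.wv
  wd := G.wd
  wu := G.wu
  zv := G.zv
  zd := G.zd
  zu := G.zu
  yv := fromRows G.yv (fromRows G.wv 1)
  yd := fromRows G.yd (fromRows G.wd 0)
  yu := fromRows G.yu (fromRows G.wu 0)

/-- The feedback `G⁺` of `G` with the approximate environment model `A`:
`G⁺ = G + G_{(w,z,y)v} A (I - G_{wv} A)⁻¹ G_{w(v,d,u)}`. -/
def plus (G : Subsystem W Z Y V D U) (A : Matrix V W TF) : Subsystem W Z Y V D U where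
  wv := G.wv + G.wv * A * (1 - G.wv * A)⁻¹ * G.wv
  wd := G.wd + G.wv * A * (1 - G.wv * A)⁻¹ * G.wd
  wu := G.wu + G.wv * A * (1 - G.wv * A)⁻¹ * G.wu
  zv := G.zv + G.zv * A * (1 - G.wv * A)⁻¹ * G.wv
  zd := G.zd + G.zv * A * (1 - G.wv * A)⁻¹ * G.wd
  zu := G.zu + G.zv * A * (1 - G.wv * A)⁻¹ * G.wu
  yv := G.yv + G.yv * A * (1 - G.wv * A)⁻¹ * G.wv
  yd := G.yd + G.yv * A * (1 - G.wv * A)⁻¹ * G.wd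
  yu := G.yu + G.yv * A * (1 - G.wv * A)⁻¹ * G.wu

/-- `G_{(y,w)u}`. -/
def ywu (G : Subsystem W Z Y V D U) : Matrix (Y ⊕ W) U TF := fromRows G.yu G.wu

/-- `G_{(y,w)d}`. -/
def ywd (G : Subsystem W Z Y V D U) : Matrix (Y ⊕ W) D TF := fromRows G.yd G.wd

/-- The output rectifier `R = [I 0 -G_{yv}; 0 I -G_{wv}]`, with input `(y, w, v)`. -/
def rectifier (G : Subsystem W Z Y V D U) : Matrix (Y ⊕ W) (Y ⊕ (W ⊕ V)) TF :=
  fromBlocks 1 (fromCols 0 (-G.yv)) 0 (fromCols 1 (-G.wv))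

/-- The matrix `X = [I, G_{yv} A (I - G_{wv} A)⁻¹; 0, (I - G_{wv} A)⁻¹]`. -/
def xMatrix (G : Subsystem W Z Y V D U) (A : Matrix V W TF) : Matrix (Y ⊕ W) (Y ⊕ W) TF :=
  fromBlocks 1 (G.yv * A * (1 - G.wv * A)⁻¹) 0 (1 - G.wv * A)⁻¹

/-- `T̂_{zd}(C) = G_{zd} + G_{zu} C (I - G_{(y,w)u} C)⁻¹ G_{(y,w)d}`. -/
def hatTzd (G : Subsystem W Z Y V D U) (C : Matrix U (Y ⊕ W) TF) : Matrix Z D TF :=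
  G.zd + G.zu * C * (1 - G.ywu * C)⁻¹ * G.ywd

/-- `T̂_{wd}(C) = G_{wd} + G_{wu} C (I - G_{(y,w)u} C)⁻¹ G_{(y,w)d}`. -/
def hatTwd (G : Subsystem W Z Y V D U) (C : Matrix U (Y ⊕ W) TF) : Matrix W D TF :=
  G.wd + G.wu * C * (1 - G.ywu * C)⁻¹ * G.ywd

end Subsystem

end RetrofitControl

end

open Matrix

noncomputable section

set_option linter.unusedSectionVars false

namespace RetrofitControl

/-! ### Proper and stable transfer functions form subrings -/

/-! For a stable plant `P`, a proper `C` is stabilizing exactly when `Q = C (I - P C)⁻¹` is in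
`RH∞`. The relation `Q = C + Q P C` encodes both the solvability of the loop and the formula for
`Q`, so everything reduces to identities between such `Q` (`internallyStable_iff`).

If `Q G_{yv} = 0`, then `Q` does not see the environment: the parameter of the whole loop is block
triangular, with diagonal blocks `E'` (that of the environment) and `Q` (`isYoulaParameter_link`).
Admissibility makes `E'` stable, so output-rectifying controllers are the proper ones with stable
`Q` and `Q G_{yv} = 0`.

Once `w` and `v` are measured, `Q` annihilates the `v`-column iff it factors through `R`. Moreover
`X R` maps the measured `u`-column to `G⁺_{(y,w)u}`, so multiplying the equation of `K̂` on the
right by `X R` gives that of `K = K̂ X R`. The converse divides by `X`, hence needs `X⁻¹` in `RH∞`.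

The closed loop is affine in `E'`; comparing `E'` with the parameter `A'` of the model gives the
formula for `T_{zd}`. -/

theorem isProperTF_iff_intDegree_le (f : TF) : IsProperTF f ↔ f.intDegree ≤ 0 := by
  unfold IsProperTF RatFunc.intDegree
  rcases eq_or_ne f 0 with rfl | hf
  · simp
  · rw [Polynomial.degree_eq_natDegree (RatFunc.num_ne_zero hf),
      Polynomial.degree_eq_natDegree f.denom_ne_zero, Nat.cast_le]
    omega

/-- The ring of proper real rational functions. -/
def properRing : Subring TF where
  carrier := {f | IsProperTF f}
  zero_mem' := by simp [isProperTF_iff_intDegree_le]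
  one_mem' := by simp [isProperTF_iff_intDegree_le]
  neg_mem' {f} hf := by
    simpa [isProperTF_iff_intDegree_le] using hf
  add_mem' {f g} hf hg := by
    simp only [Set.mem_ofPred_eq, isProperTF_iff_intDegree_le] at *
    -- `intDegree 0 = 0`, not `-∞`, so the degree bounds require the zero cases to be split off.
    rcases eq_or_ne g 0 with rfl | hg0
    · simpa using hf
    rcases eq_or_ne (f + g) 0 with h | h
    · simp [h]
    · exact (RatFunc.intDegree_add_le hg0 h).trans (max_le hf hg)
  mul_mem' {f g} hf hg := by
    simp only [Set.mem_ofPred_eq, isProperTF_iff_intDegree_le] at *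
    rcases eq_or_ne f 0 with rfl | hf0
    · simp
    rcases eq_or_ne g 0 with rfl | hg0
    · simp
    rw [RatFunc.intDegree_mul hf0 hg0]
    omega

/-- Cancellation can only remove poles, so a divisibility suffices and the reduced denominator of a
sum or product need not be computed. -/
theorem IsStableTF.of_denom_dvd_mul {f g h : TF} (hf : IsStableTF f) (hg : IsStableTF g)
    (hd : h.denom ∣ f.denom * g.denom) : IsStableTF h := by
  intro s hs
  obtain ⟨q, hq⟩ := hd
  have h0 : Polynomial.aeval s f.denom * Polynomial.aeval s g.denom = 0 := by
    rw [← map_mul, hq, map_mul, hs, zero_mul]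
  rcases mul_eq_zero.1 h0 with h | h
  exacts [hf s h, hg s h]

/-- The ring of real rational functions without poles in the closed right half plane. -/
def stableRing : Subring TF where
  carrier := {f | IsStableTF f}
  zero_mem' := by intro s; simp
  one_mem' := by intro s; simp
  add_mem' {f g} hf hg := IsStableTF.of_denom_dvd_mul hf hg (RatFunc.denom_add_dvd f g)
  mul_mem' {f g} hf hg := IsStableTF.of_denom_dvd_mul hf hg (RatFunc.denom_mul_dvd f g)
  neg_mem' {f} hf := by
    have h1 : IsStableTF (-1 : TF) := by
      have h : (-1 : TF) = algebraMap (Polynomial ℝ) TF (-1) := by simp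
      intro s
      rw [h, RatFunc.denom_algebraMap]
      simp
    refine IsStableTF.of_denom_dvd_mul h1 hf ?_
    simpa using RatFunc.denom_mul_dvd (-1) f

/-! ### Matrices with entries in a subring -/

/-- All entries of `M` lie in `S`. -/
def EntriesIn {R : Type*} [Ring R] (S : Subring R) {m n : Type*} (M : Matrix m n R) : Prop :=
  ∀ i j, M i j ∈ S

theorem isProper_iff_entriesIn {m n : Type*} {M : Matrix m n TF} :
    IsProper M ↔ EntriesIn properRing M := Iff.rfl

theorem isRHInf_iff_entriesIn {m n : Type*} {M : Matrix m n TF} :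
    IsRHInf M ↔ EntriesIn (properRing ⊓ stableRing) M := Iff.rfl

namespace EntriesIn

variable {R : Type*} [Ring R] {S : Subring R} {l m n o : Type*}

theorem zero : EntriesIn S (0 : Matrix m n R) := fun _ _ => S.zero_mem

theorem one [DecidableEq m] : EntriesIn S (1 : Matrix m m R) := fun i j => by
  rw [Matrix.one_apply]
  split_ifs
  exacts [S.one_mem, S.zero_mem]

theorem add {M N : Matrix m n R} (hM : EntriesIn S M) (hN : EntriesIn S N) :
    EntriesIn S (M + N) := fun i j => S.add_mem (hM i j) (hN i j)

theorem neg {M : Matrix m n R} (hM : EntriesIn S M) : EntriesIn S (-M) :=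
  fun i j => S.neg_mem (hM i j)

theorem sub {M N : Matrix m n R} (hM : EntriesIn S M) (hN : EntriesIn S N) :
    EntriesIn S (M - N) := fun i j => S.sub_mem (hM i j) (hN i j)

theorem mul [Fintype m] {M : Matrix l m R} {N : Matrix m n R} (hM : EntriesIn S M)
    (hN : EntriesIn S N) : EntriesIn S (M * N) :=
  fun i j => S.sum_mem fun k _ => S.mul_mem (hM i k) (hN k j)

theorem fromRows {M : Matrix l n R} {N : Matrix m n R} (hM : EntriesIn S M)
    (hN : EntriesIn S N) : EntriesIn S (Matrix.fromRows M N)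
  | Sum.inl i, j => hM i j
  | Sum.inr i, j => hN i j

theorem fromCols {M : Matrix l m R} {N : Matrix l n R} (hM : EntriesIn S M)
    (hN : EntriesIn S N) : EntriesIn S (Matrix.fromCols M N)
  | i, Sum.inl j => hM i j
  | i, Sum.inr j => hN i j

theorem fromBlocks {A : Matrix n l R} {B : Matrix n m R} {C : Matrix o l R} {D : Matrix o m R}
    (hA : EntriesIn S A) (hB : EntriesIn S B) (hC : EntriesIn S C) (hD : EntriesIn S D) :
    EntriesIn S (Matrix.fromBlocks A B C D)
  | Sum.inl i, Sum.inl j => hA i j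
  | Sum.inl i, Sum.inr j => hB i j
  | Sum.inr i, Sum.inl j => hC i j
  | Sum.inr i, Sum.inr j => hD i j

end EntriesIn

/-! ### The Youla parameter of a feedback loop -/

section Youla

variable {R : Type*} [CommRing R] {p q : Type*} [Fintype p] [DecidableEq p]
  [Fintype q] [DecidableEq q]

/-- `Q = C (I - P C)⁻¹`, in division-free form. -/
def IsYoulaParameter (P : Matrix p q R) (C Q : Matrix q p R) : Prop := Q = C + Q * P * C

namespace IsYoulaParameter

variable {P : Matrix p q R} {C Q : Matrix q p R}

/-- The difference of the two sides is `P (Q - C - Q P C)`. -/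
theorem mul_eq_one (h : IsYoulaParameter P C Q) : (1 + P * Q) * (1 - P * C) = 1 := by
  have h' : P * Q = P * C + P * Q * P * C := by
    simpa only [Matrix.mul_add, Matrix.mul_assoc] using congrArg (P * ·) h
  simp only [Matrix.add_mul, Matrix.mul_sub, Matrix.one_mul, Matrix.mul_one,
    ← Matrix.mul_assoc]
  rw [← sub_eq_zero] at h' ⊢
  refine Eq.trans ?_ h'
  abel

theorem mul_eq_one' (h : IsYoulaParameter P C Q) : (1 - P * C) * (1 + P * Q) = 1 :=
  mul_eq_one_comm.1 h.mul_eq_one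

theorem isUnit (h : IsYoulaParameter P C Q) : IsUnit (1 - P * C) :=
  ⟨⟨_, _, h.mul_eq_one', h.mul_eq_one⟩, rfl⟩

theorem inv_eq (h : IsYoulaParameter P C Q) : (1 - P * C)⁻¹ = 1 + P * Q :=
  Matrix.inv_eq_left_inv h.mul_eq_one

/-- One-sided inverses of square matrices are two-sided, which makes the left and right forms of the
relation equivalent. -/
theorem symm (h : IsYoulaParameter P C Q) : Q = C + C * P * Q := by
  have h1 : Q * (1 - P * C) = C := by
    rw [Matrix.mul_sub, Matrix.mul_one, ← Matrix.mul_assoc, sub_eq_iff_eq_add]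
    exact h
  calc Q = Q * ((1 - P * C) * (1 + P * Q)) := by rw [h.mul_eq_one', Matrix.mul_one]
    _ = C * (1 + P * Q) := by rw [← Matrix.mul_assoc, h1]
    _ = C + C * P * Q := by rw [Matrix.mul_add, Matrix.mul_one, Matrix.mul_assoc]

/-- Transposition exchanges the two forms. -/
theorem of_symm (h : Q = C + C * P * Q) : IsYoulaParameter P C Q := by
  have ht : IsYoulaParameter Pᵀ Cᵀ Qᵀ := by
    simpa only [transpose_add, transpose_mul, Matrix.mul_assoc, IsYoulaParameter] using
      congrArg transpose h
  have h' := congrArg transpose ht.symm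
  simpa only [transpose_add, transpose_mul, transpose_transpose, Matrix.mul_assoc,
    IsYoulaParameter] using h'

theorem eq_mul_inv (h : IsYoulaParameter P C Q) : C * (1 - P * C)⁻¹ = Q := by
  rw [h.inv_eq, Matrix.mul_add, Matrix.mul_one, ← Matrix.mul_assoc]
  exact h.symm.symm

theorem of_isUnit (h : IsUnit (1 - P * C)) : IsYoulaParameter P C (C * (1 - P * C)⁻¹) := by
  have h1 := Matrix.nonsing_inv_mul _ ((Matrix.isUnit_iff_isUnit_det _).1 h)
  have h2 : C * (1 - P * C)⁻¹ * (1 - P * C) = C := by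
    rw [Matrix.mul_assoc, h1, Matrix.mul_one]
  rw [Matrix.mul_sub, Matrix.mul_one, ← Matrix.mul_assoc, sub_eq_iff_eq_add] at h2
  exact h2

theorem controller_mul_eq_one (h : IsYoulaParameter P C Q) :
    (1 - C * P) * (1 + Q * P) = 1 := by
  have h' : Q * P = C * P + C * P * Q * P := by
    simpa only [Matrix.add_mul] using congrArg (· * P) h.symm
  simp only [Matrix.sub_mul, Matrix.mul_add, Matrix.one_mul, Matrix.mul_one,
    ← Matrix.mul_assoc]
  rw [← sub_eq_zero] at h' ⊢
  refine Eq.trans ?_ h'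
  abel

theorem controller_isUnit (h : IsYoulaParameter P C Q) : IsUnit (1 + Q * P) :=
  ⟨⟨_, _, mul_eq_one_comm.1 h.controller_mul_eq_one, h.controller_mul_eq_one⟩, rfl⟩

theorem controller_eq (h : IsYoulaParameter P C Q) : C = (1 + Q * P)⁻¹ * Q := by
  have h1 : (1 + Q * P) * C = Q := by
    rw [Matrix.add_mul, Matrix.one_mul]
    exact Eq.symm h
  rw [Matrix.inv_eq_left_inv h.controller_mul_eq_one]
  calc C = (1 - C * P) * (1 + Q * P) * C := by rw [h.controller_mul_eq_one, Matrix.one_mul]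
    _ = _ := by rw [Matrix.mul_assoc, h1]

theorem of_controller (hu : IsUnit (1 + Q * P)) :
    IsYoulaParameter P ((1 + Q * P)⁻¹ * Q) Q := by
  have h1 := Matrix.mul_nonsing_inv _ ((Matrix.isUnit_iff_isUnit_det _).1 hu)
  have h2 : (1 + Q * P) * ((1 + Q * P)⁻¹ * Q) = Q := by
    rw [← Matrix.mul_assoc, h1, Matrix.one_mul]
  rw [Matrix.add_mul, Matrix.one_mul] at h2
  exact h2.symm

/-- The inverse of the loop matrix in terms of the Youla parameter. -/
theorem loop_inv_mul (h : IsYoulaParameter P C Q) :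
    fromBlocks (1 + Q * P) Q (P * (1 + Q * P)) (1 + P * Q) * fromBlocks 1 (-C) (-P) 1 = 1 := by
  have h1 : (1 + Q * P) * C = Q := by
    rw [Matrix.add_mul, Matrix.one_mul]
    exact Eq.symm h
  rw [fromBlocks_multiply, ← fromBlocks_one]
  congr 1
  · simp
  · rw [Matrix.mul_neg, h1]; simp
  · simp [Matrix.mul_add, Matrix.add_mul, Matrix.mul_assoc]
  · rw [Matrix.mul_neg, Matrix.mul_assoc, h1]; simp

end IsYoulaParameter

/-- Youla parametrization for a stable plant. -/
theorem internallyStable_iff {P : Matrix p q TF} (hP : IsRHInf P) {C : Matrix q p TF} :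
    InternallyStable P C ↔ ∃ Q, IsRHInf Q ∧ IsYoulaParameter P C Q := by
  constructor
  · rintro ⟨hu, hs⟩
    set N := (fromBlocks 1 (-C) (-P) 1 : Matrix (q ⊕ p) (q ⊕ p) TF)⁻¹ with hN
    have h1 : N * fromBlocks 1 (-C) (-P) 1 = 1 :=
      Matrix.nonsing_inv_mul _ ((Matrix.isUnit_iff_isUnit_det _).1 hu)
    -- `Q` is the map `r₂ ↦ a`. The first block row of `N * loop = 1` says `N₁₁ = 1 + N₁₂ P` and
    -- `N₁₂ = N₁₁ C`; eliminating `N₁₁` gives the relation.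
    refine ⟨N.toBlocks₁₂, fun i j => hs _ _, ?_⟩
    rw [← fromBlocks_toBlocks N, fromBlocks_multiply, ← fromBlocks_one,
      fromBlocks_inj] at h1
    obtain ⟨ha, hb, -, -⟩ := h1
    have ha' : N.toBlocks₁₁ = 1 + N.toBlocks₁₂ * P := by
      rw [Matrix.mul_one, Matrix.mul_neg] at ha
      rw [← ha]; abel
    rw [Matrix.mul_one, Matrix.mul_neg, ha', Matrix.add_mul, Matrix.one_mul] at hb
    exact (neg_add_eq_zero.1 hb).symm
  · rintro ⟨Q, hQ, h⟩
    have h1 := mul_eq_one_comm.1 h.loop_inv_mul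
    refine ⟨⟨⟨_, _, h1, h.loop_inv_mul⟩, rfl⟩, ?_⟩
    rw [Matrix.inv_eq_left_inv h.loop_inv_mul]
    rw [isRHInf_iff_entriesIn] at *
    have hQP := EntriesIn.one.add (hQ.mul hP)
    exact hQP.fromBlocks hQ (hP.mul hQP) (EntriesIn.one.add (hP.mul hQ))

end Youla

/-! ### Subsystems -/

theorem entriesIn_subsystem {W Z Y V D U : Type*} {G : Subsystem W Z Y V D U} {S : Subring TF}
    (h : EntriesIn S G.toMatrix) :
    (EntriesIn S G.wv ∧ EntriesIn S G.wd ∧ EntriesIn S G.wu) ∧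
    (EntriesIn S G.zv ∧ EntriesIn S G.zd ∧ EntriesIn S G.zu) ∧
    (EntriesIn S G.yv ∧ EntriesIn S G.yd ∧ EntriesIn S G.yu) :=
  ⟨⟨fun i j => h (.inl i) (.inl j), fun i j => h (.inl i) (.inr (.inl j)),
      fun i j => h (.inl i) (.inr (.inr j))⟩,
    ⟨fun i j => h (.inr (.inl i)) (.inl j), fun i j => h (.inr (.inl i)) (.inr (.inl j)),
      fun i j => h (.inr (.inl i)) (.inr (.inr j))⟩,
    ⟨fun i j => h (.inr (.inr i)) (.inl j), fun i j => h (.inr (.inr i)) (.inr (.inl j)),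
      fun i j => h (.inr (.inr i)) (.inr (.inr j))⟩⟩

theorem fromCols_add_fromCols {R l m n : Type*} [Add R] (A C : Matrix l m R) (B D : Matrix l n R) :
    fromCols A B + fromCols C D = fromCols (A + C) (B + D) := by
  ext i (j | j) <;> rfl

namespace Subsystem

variable {W Z Y V D U : Type*}
  [Fintype W] [DecidableEq W] [Fintype Z] [DecidableEq Z] [Fintype Y] [DecidableEq Y]
  [Fintype V] [DecidableEq V] [Fintype D] [DecidableEq D] [Fintype U] [DecidableEq U]

/-- The Youla parameter of `link E K`, for an environment with Youla parameter `E'` and a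
controller whose Youla parameter `Q` satisfies `Q G_{yv} = 0`. -/
def linkParameter (G : Subsystem W Z Y V D U) (E' : Matrix V W TF) (Q : Matrix U Y TF) :
    Matrix (V ⊕ (D ⊕ U)) (W ⊕ (Z ⊕ Y)) TF :=
  fromBlocks E' (fromCols 0 (E' * G.wu * Q)) 0 (fromBlocks 0 0 0 Q)

/-- Since `Q G_{yv} = 0`, no term leads from `v` back through the controller. The one mixed block,
from `y` to `v`, is the controller relation multiplied on the left by `E' G_{wu}`. -/
theorem isYoulaParameter_link (G : Subsystem W Z Y V D U) {E E' : Matrix V W TF}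
    {K Q : Matrix U Y TF} (hE : IsYoulaParameter G.wv E E') (hK : IsYoulaParameter G.yu K Q)
    (hQ : Q * G.yv = 0) :
    IsYoulaParameter G.toMatrix (G.link E K) (G.linkParameter E' Q) := by
  have hE1 : E' = E + E' * (G.wv * E) := by rw [← Matrix.mul_assoc]; exact hE
  have hK1 : Q = K + Q * (G.yu * K) := by rw [← Matrix.mul_assoc]; exact hK
  have hK2 : E' * (G.wu * Q) = E' * (G.wu * K) + E' * (G.wu * (Q * (G.yu * K))) := by
    rw [← Matrix.mul_add, ← Matrix.mul_add, ← hK1]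
  unfold IsYoulaParameter linkParameter toMatrix link
  simp only [Matrix.mul_assoc, fromBlocks_multiply, fromBlocks_add, fromCols_mul_fromBlocks,
    fromCols_mul_fromRows, mul_fromCols, Matrix.mul_zero, Matrix.zero_mul,
    add_zero, zero_add, hQ, fromCols_add_fromCols, fromBlocks_mul_fromRows, fromRows_zero, ← hK1]
  rw [fromBlocks_inj]
  refine ⟨hE1, ?_, rfl, rfl⟩
  ext i (j | j)
  · simp
  · simp [hK2, Matrix.add_mul, Matrix.mul_assoc]

theorem IsAdmissible.exists_youlaParameter {G : Subsystem W Z Y V D U} (hG : IsRHInf G.toMatrix)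
    {E : Matrix V W TF} (hE : G.IsAdmissible E) :
    ∃ E', IsRHInf E' ∧ IsYoulaParameter G.wv E E' := by
  obtain ⟨Q, hQ, h⟩ := (internallyStable_iff hG).1 hE.2
  have hs := h.symm
  have hQ' : Q = (G.link E 0) * (1 + G.toMatrix * Q) := by
    rw [Matrix.mul_add, Matrix.mul_one, ← Matrix.mul_assoc]; exact hs
  -- Without controller the lower block row of `link E 0` vanishes, hence so does that of `Q`. The
  -- upper left block of `Q = C + C P Q` then involves only `G_{wv}`.
  have h21 : Q.toBlocks₂₁ = 0 := by
    rw [hQ', ← fromBlocks_toBlocks (1 + G.toMatrix * Q), link, fromBlocks_multiply]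
    simp
  refine ⟨Q.toBlocks₁₁, fun i j => hQ _ _, ?_⟩
  have h11 := congrArg toBlocks₁₁ hs
  rw [← fromBlocks_toBlocks Q, h21, link, toMatrix] at h11
  simp only [Matrix.mul_assoc, fromBlocks_multiply, fromBlocks_add, toBlocks_fromBlocks₁₁,
    Matrix.mul_zero, Matrix.zero_mul, add_zero] at h11
  exact IsYoulaParameter.of_symm (by rw [Matrix.mul_assoc]; exact h11)

theorem internallyStable_link {G : Subsystem W Z Y V D U} (hG : IsRHInf G.toMatrix)
    {E : Matrix V W TF} (hE : G.IsAdmissible E) {K Q : Matrix U Y TF} (hQs : IsRHInf Q)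
    (hK : IsYoulaParameter G.yu K Q) (hQ : Q * G.yv = 0) :
    InternallyStable G.toMatrix (G.link E K) := by
  obtain ⟨E', hE', h⟩ := hE.exists_youlaParameter hG
  refine (internallyStable_iff hG).2 ⟨_, ?_, G.isYoulaParameter_link h hK hQ⟩
  obtain ⟨⟨-, -, hwu⟩, -, -⟩ := entriesIn_subsystem (isRHInf_iff_entriesIn.1 hG)
  rw [isRHInf_iff_entriesIn] at *
  exact hE'.fromBlocks (.fromCols .zero ((hE'.mul hwu).mul hQs)) .zero
    (.fromBlocks .zero .zero .zero hQs)

/-- For a stable subsystem, output-rectifying retrofit controllers are exactly the proper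
controllers with a stable Youla parameter annihilating `G_{yv}`. -/
theorem isOutputRectifying_iff {G : Subsystem W Z Y V D U} (hG : IsRHInf G.toMatrix)
    {K : Matrix U Y TF} :
    G.IsOutputRectifying K ↔
      IsProper K ∧ ∃ Q, IsRHInf Q ∧ IsYoulaParameter G.yu K Q ∧ Q * G.yv = 0 := by
  constructor
  · rintro ⟨⟨hp, -⟩, Q, hQ, hu, rfl, h0⟩
    exact ⟨hp, Q, hQ, .of_controller hu, h0⟩
  · rintro ⟨hp, Q, hQ, hK, h0⟩
    exact ⟨⟨hp, fun E hE => internallyStable_link hG hE hQ hK h0⟩, Q, hQ,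
      hK.controller_isUnit, hK.controller_eq, h0⟩

/-- By `(I - P C)⁻¹ = I + P Q` the closed loop is `P + P Q P`, with `P` the whole subsystem and `Q`
the triangular link parameter; only its `d`-column and `z`-row are needed. -/
theorem closedLoop_eq (G : Subsystem W Z Y V D U) {E E' : Matrix V W TF}
    {K Q : Matrix U Y TF} (hE : IsYoulaParameter G.wv E E') (hK : IsYoulaParameter G.yu K Q)
    (hQ : Q * G.yv = 0) :
    G.closedLoop E K =
      G.zd + (G.zv * E' * G.wd + (G.zu + G.zv * E' * G.wu) * Q * G.yd) := by
  have h : (G.linkParameter E' Q * G.toMatrix).submatrix id (fun j => Sum.inr (Sum.inl j)) =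
      fromRows (E' * G.wd + E' * G.wu * Q * G.yd) (fromRows 0 (Q * G.yd)) := by
    unfold linkParameter toMatrix
    simp only [fromBlocks_multiply, fromCols_mul_fromBlocks, fromCols_mul_fromRows, mul_fromCols,
      Matrix.zero_mul, zero_add]
    ext (i | i | i) j <;> simp
  unfold closedLoop
  rw [(G.isYoulaParameter_link hE hK hQ).inv_eq, Matrix.add_mul, Matrix.one_mul,
    Matrix.mul_assoc]
  have h2 : (G.toMatrix * (G.linkParameter E' Q * G.toMatrix)).submatrix
      (fun i : Z => (Sum.inr (Sum.inl i) : W ⊕ (Z ⊕ Y)))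
      (fun j : D => (Sum.inr (Sum.inl j) : V ⊕ (D ⊕ U))) =
      (fromCols G.zv (fromCols G.zd G.zu) : Matrix Z (V ⊕ (D ⊕ U)) TF) *
        (fromRows (E' * G.wd + E' * G.wu * Q * G.yd) (fromRows 0 (Q * G.yd)) :
          Matrix (V ⊕ (D ⊕ U)) D TF) := by
    rw [← h]
    rfl
  change G.zd + (G.toMatrix * (G.linkParameter E' Q * G.toMatrix)).submatrix
    (fun i : Z => (Sum.inr (Sum.inl i) : W ⊕ (Z ⊕ Y)))
    (fun j : D => (Sum.inr (Sum.inl j) : V ⊕ (D ⊕ U))) = _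
  rw [h2, fromCols_mul_fromRows, fromCols_mul_fromRows]
  congr 1
  simp only [Matrix.mul_add, Matrix.add_mul, Matrix.mul_assoc, Matrix.mul_zero, zero_add]
  abel

/-! ### Measured interconnection signals -/

theorem isRHInf_measured {G : Subsystem W Z Y V D U} (hG : IsRHInf G.toMatrix) :
    IsRHInf G.measured.toMatrix := by
  obtain ⟨⟨h1, h2, h3⟩, ⟨h4, h5, h6⟩, h7, h8, h9⟩ :=
    entriesIn_subsystem (isRHInf_iff_entriesIn.1 hG)
  rw [isRHInf_iff_entriesIn]
  exact h1.fromBlocks (h2.fromCols h3) (h4.fromRows (h7.fromRows (h1.fromRows .one)))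
    (h5.fromBlocks h6 (h8.fromRows (h2.fromRows .zero)) (h9.fromRows (h3.fromRows .zero)))

section Rectifier

variable (G : Subsystem W Z Y V D U)

/-- The embedding of `(y, w)` into `(y, w, v)`, a right inverse of the rectifier. -/
def rectifierInv (_G : Subsystem W Z Y V D U) : Matrix (Y ⊕ (W ⊕ V)) (Y ⊕ W) TF :=
  fromBlocks 1 0 0 (fromRows 1 0)

theorem rectifier_mul_yv : G.rectifier * G.measured.yv = 0 := by
  unfold rectifier measured
  simp [fromBlocks_mul_fromRows, fromCols_mul_fromRows]

theorem rectifier_mul_yu : G.rectifier * G.measured.yu = G.ywu := by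
  unfold rectifier measured ywu
  simp [fromBlocks_mul_fromRows, fromCols_mul_fromRows]

theorem rectifier_mul_yd : G.rectifier * G.measured.yd = G.ywd := by
  unfold rectifier measured ywd
  simp [fromBlocks_mul_fromRows, fromCols_mul_fromRows]

/-- A matrix annihilating the columns of `v` factors through the rectifier. -/
theorem mul_rectifierInv_mul_rectifier {Q : Matrix U (Y ⊕ (W ⊕ V)) TF}
    (hQ : Q * G.measured.yv = 0) : Q * G.rectifierInv * G.rectifier = Q := by
  obtain ⟨Q1, Q2, rfl⟩ : ∃ Q1 Q2, Q = fromCols Q1 Q2 := ⟨_, _, (fromCols_toCols Q).symm⟩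
  obtain ⟨Q2, Q3, rfl⟩ : ∃ Q3 Q4, Q2 = fromCols Q3 Q4 := ⟨_, _, (fromCols_toCols Q2).symm⟩
  -- The identity block in the `v`-column lets the `v`-part of `Q` be solved for.
  have h : Q3 = -(Q1 * G.yv) + -(Q2 * G.wv) := by
    simp only [measured, fromCols_mul_fromRows, Matrix.mul_one] at hQ
    rw [← add_assoc, add_comm] at hQ
    rw [eq_neg_of_add_eq_zero_left hQ, neg_add]
  rw [h]
  unfold rectifierInv rectifier
  simp [fromCols_mul_fromBlocks, fromCols_mul_fromRows, mul_fromCols]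
  ext i (j | j | j) <;> simp

end Rectifier

/-! ### The approximate environment model -/

section Plus

variable (G : Subsystem W Z Y V D U) {A A' : Matrix V W TF}

/-- In this form `X` is stable as soon as `A'` is, even when `A` itself is unstable. -/
theorem xMatrix_eq (h : IsYoulaParameter G.wv A A') :
    G.xMatrix A = fromBlocks 1 (G.yv * A') 0 (1 + G.wv * A') := by
  rw [xMatrix, Matrix.mul_assoc, h.eq_mul_inv, h.inv_eq]

/-- The inverse of `X` is affine in `A`, which is why stability of `A` makes it stable. -/
theorem xMatrix_mul (h : IsYoulaParameter G.wv A A') :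
    G.xMatrix A * (fromBlocks 1 (-(G.yv * A)) 0 (1 - G.wv * A) :
      Matrix (Y ⊕ W) (Y ⊕ W) TF) = 1 := by
  have h1 : A' * (1 - G.wv * A) = A := by
    rw [Matrix.mul_sub, Matrix.mul_one, ← Matrix.mul_assoc, sub_eq_iff_eq_add]
    exact h
  have h2 : G.yv * A' * (1 - G.wv * A) = G.yv * A := by rw [Matrix.mul_assoc, h1]
  rw [G.xMatrix_eq h, fromBlocks_multiply, ← fromBlocks_one, h.mul_eq_one, h2]
  simp

/-- Both sides are `G_{(y,w)u} + G_{(y,w)v} A' G_{wu}`, because `X = I + G_{(y,w)v} A' [0 I]`. -/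
theorem xMatrix_mul_ywu (h : IsYoulaParameter G.wv A A') :
    G.xMatrix A * G.ywu = (G.plus A).ywu := by
  rw [G.xMatrix_eq h, ywu, ywu, plus, fromBlocks_mul_fromRows]
  simp only [Matrix.mul_assoc, Matrix.one_mul, Matrix.zero_mul, zero_add, Matrix.add_mul,
    h.eq_mul_inv]

theorem xMatrix_mul_ywd (h : IsYoulaParameter G.wv A A') :
    G.xMatrix A * G.ywd = (G.plus A).ywd := by
  rw [G.xMatrix_eq h, ywd, ywd, plus, fromBlocks_mul_fromRows]
  simp only [Matrix.mul_assoc, Matrix.one_mul, Matrix.zero_mul, zero_add, Matrix.add_mul,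
    h.eq_mul_inv]

variable {G}

theorem isRHInf_xMatrix (hG : IsRHInf G.toMatrix) (h : IsYoulaParameter G.wv A A')
    (hA' : IsRHInf A') : IsRHInf (G.xMatrix A) := by
  obtain ⟨⟨hwv, -⟩, -, hyv, -⟩ := entriesIn_subsystem (isRHInf_iff_entriesIn.1 hG)
  rw [G.xMatrix_eq h]
  rw [isRHInf_iff_entriesIn] at *
  exact .fromBlocks .one (hyv.mul hA') .zero (.add .one (hwv.mul hA'))

theorem isRHInf_rectifier (hG : IsRHInf G.toMatrix) : IsRHInf G.rectifier := by
  obtain ⟨⟨hwv, -⟩, -, hyv, -⟩ := entriesIn_subsystem (isRHInf_iff_entriesIn.1 hG)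
  rw [isRHInf_iff_entriesIn]
  exact .fromBlocks .one (.fromCols .zero hyv.neg) .zero (.fromCols .one hwv.neg)

theorem isRHInf_plus_ywu (hG : IsRHInf G.toMatrix) (h : IsYoulaParameter G.wv A A')
    (hA' : IsRHInf A') : IsRHInf (G.plus A).ywu := by
  obtain ⟨⟨-, -, hwu⟩, -, -, -, hyu⟩ := entriesIn_subsystem (isRHInf_iff_entriesIn.1 hG)
  have hX := isRHInf_xMatrix hG h hA'
  rw [← G.xMatrix_mul_ywu h]
  rw [isRHInf_iff_entriesIn] at *
  exact hX.mul (hyu.fromRows hwu)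

/-- A Youla parameter for `G⁺_{(y,w)u}` yields one for the measured subsystem. -/
theorem isYoulaParameter_rectified (h : IsYoulaParameter G.wv A A')
    {Khat Qhat : Matrix U (Y ⊕ W) TF} (hQ : IsYoulaParameter (G.plus A).ywu Khat Qhat) :
    IsYoulaParameter G.measured.yu (Khat * G.xMatrix A * G.rectifier)
      (Qhat * G.xMatrix A * G.rectifier) := by
  unfold IsYoulaParameter
  calc Qhat * G.xMatrix A * G.rectifier
      = (Khat + Qhat * (G.xMatrix A * (G.rectifier * G.measured.yu)) * Khat) * G.xMatrix A *
          G.rectifier := by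
        rw [G.rectifier_mul_yu, G.xMatrix_mul_ywu h]
        exact congrArg (· * G.xMatrix A * G.rectifier) hQ
    _ = _ := by simp only [Matrix.add_mul, Matrix.mul_assoc]

theorem mul_rectifier_mul_yv (M : Matrix U (Y ⊕ W) TF) :
    M * G.rectifier * G.measured.yv = 0 := by
  rw [Matrix.mul_assoc, rectifier_mul_yv, Matrix.mul_zero]

theorem isOutputRectifying_of_isStabilizing (hG : IsRHInf G.toMatrix)
    (h : IsYoulaParameter G.wv A A') (hA' : IsRHInf A') {Khat : Matrix U (Y ⊕ W) TF}
    (hK : IsStabilizing (G.plus A).ywu Khat) :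
    G.measured.IsOutputRectifying (Khat * G.xMatrix A * G.rectifier) := by
  obtain ⟨Qhat, hQs, hQ⟩ := (internallyStable_iff (isRHInf_plus_ywu hG h hA')).1 hK.2
  have hX := isRHInf_xMatrix hG h hA'
  have hR := isRHInf_rectifier hG
  rw [isOutputRectifying_iff (isRHInf_measured hG)]
  refine ⟨?_, _, ?_, isYoulaParameter_rectified h hQ, mul_rectifier_mul_yv _⟩
  · have hXp : EntriesIn properRing (G.xMatrix A) := fun i j => (hX i j).1
    have hRp : EntriesIn properRing G.rectifier := fun i j => (hR i j).1
    exact ((isProper_iff_entriesIn.1 hK.1).mul hXp).mul hRp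
  · rw [isRHInf_iff_entriesIn] at *
    exact (hQs.mul hX).mul hR

/-- Both `K` and its parameter `Q` annihilate the `v`-column, so both factor through `X R`. The same
right factor `R⁺ X⁻¹`, with `R⁺` the embedding `rectifierInv`, yields `K̂` and its parameter. -/
theorem exists_isStabilizing_of_isOutputRectifying (hG : IsRHInf G.toMatrix)
    (h : IsYoulaParameter G.wv A A') (hA' : IsRHInf A') (hX : IsRHInf (G.xMatrix A)⁻¹)
    {K : Matrix U (Y ⊕ (W ⊕ V)) TF} (hK : G.measured.IsOutputRectifying K) :
    ∃ Khat, IsStabilizing (G.plus A).ywu Khat ∧ K = Khat * G.xMatrix A * G.rectifier := by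
  obtain ⟨hp, Q, hQs, hQ, h0⟩ := (isOutputRectifying_iff (isRHInf_measured hG)).1 hK
  have hXX : (G.xMatrix A)⁻¹ * G.xMatrix A = 1 := by
    rw [Matrix.inv_eq_right_inv (G.xMatrix_mul h)]
    exact mul_eq_one_comm.1 (G.xMatrix_mul h)
  have hfac : ∀ M : Matrix U (Y ⊕ (W ⊕ V)) TF, M * G.measured.yv = 0 →
      M * G.rectifierInv * (G.xMatrix A)⁻¹ * G.xMatrix A * G.rectifier = M := by
    intro M hM
    rw [Matrix.mul_assoc _ _ (G.xMatrix A), hXX, Matrix.mul_one,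
      G.mul_rectifierInv_mul_rectifier hM]
  have hK0 : K * G.measured.yv = 0 := by
    rw [hQ.controller_eq, Matrix.mul_assoc, h0, Matrix.mul_zero]
  refine ⟨K * G.rectifierInv * (G.xMatrix A)⁻¹, ⟨?_, ?_⟩, (hfac K hK0).symm⟩
  · have hXp : EntriesIn properRing (G.xMatrix A)⁻¹ := fun i j => (hX i j).1
    exact ((isProper_iff_entriesIn.1 hp).mul
      (.fromBlocks .one .zero .zero (.fromRows .one .zero))).mul hXp
  · refine (internallyStable_iff (isRHInf_plus_ywu hG h hA')).2
      ⟨Q * G.rectifierInv * (G.xMatrix A)⁻¹, ?_, ?_⟩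
    · rw [isRHInf_iff_entriesIn] at *
      exact (hQs.mul (.fromBlocks .one .zero .zero (.fromRows .one .zero))).mul hX
    · have h1 : Q * G.rectifierInv * (G.xMatrix A)⁻¹ * (G.plus A).ywu = Q * G.measured.yu := by
        rw [← G.xMatrix_mul_ywu h, ← G.rectifier_mul_yu, ← Matrix.mul_assoc, ← Matrix.mul_assoc,
          hfac Q h0]
      unfold IsYoulaParameter
      rw [h1]
      simpa only [Matrix.add_mul, Matrix.mul_assoc] using
        congrArg (· * G.rectifierInv * (G.xMatrix A)⁻¹) hQ

/-- At `E' = A'` the affine formula gives the `G⁺` response; the rest is `G_{zv} (E' - A')` applied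
to a signal that `I + G_{wv} A'` turns into the `w`-response of `G⁺`. Only solvability of the loops
matters, not stability. -/
theorem closedLoop_rectified (h : IsYoulaParameter G.wv A A')
    {Khat Qhat : Matrix U (Y ⊕ W) TF} (hQ : IsYoulaParameter (G.plus A).ywu Khat Qhat)
    {E : Matrix V W TF} (hE : IsUnit (1 - G.wv * E)) :
    IsUnit (1 - G.measured.toMatrix *
      G.measured.link E (Khat * G.xMatrix A * G.rectifier)) ∧
    G.measured.closedLoop E (Khat * G.xMatrix A * G.rectifier) =
      (G.plus A).hatTzd Khat +
        G.zv * (1 - E * G.wv)⁻¹ * (E - A) * (G.plus A).hatTwd Khat := by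
  have hE' := IsYoulaParameter.of_isUnit hE
  set E' := E * (1 - G.wv * E)⁻¹
  have hY := isYoulaParameter_rectified h hQ
  have h0 := mul_rectifier_mul_yv (G := G) (Qhat * G.xMatrix A)
  refine ⟨(G.measured.isYoulaParameter_link hE' hY h0).isUnit, ?_⟩
  rw [G.measured.closedLoop_eq hE' hY h0]
  have hyd : Qhat * G.xMatrix A * G.rectifier * G.measured.yd = Qhat * (G.plus A).ywd := by
    rw [← G.xMatrix_mul_ywd h, ← G.rectifier_mul_yd]
    simp only [Matrix.mul_assoc]
  -- the two environments differ by a multiple of `E - A`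
  have hdiff : (1 - E * G.wv)⁻¹ * (E - A) * (1 + G.wv * A') = E' - A' := by
    have h1 : (1 - E * G.wv)⁻¹ = 1 + E' * G.wv :=
      Matrix.inv_eq_right_inv hE'.controller_mul_eq_one
    have h2 : (1 + E' * G.wv) * E = E' := by
      rw [Matrix.add_mul, Matrix.one_mul]; exact Eq.symm hE'
    have h3 : A * (1 + G.wv * A') = A' := by
      rw [Matrix.mul_add, Matrix.mul_one, ← Matrix.mul_assoc]; exact h.symm.symm
    rw [h1, Matrix.mul_sub, h2, Matrix.sub_mul, Matrix.mul_assoc _ A, h3, Matrix.mul_add,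
      Matrix.add_mul, Matrix.mul_one, Matrix.one_mul, ← Matrix.mul_assoc]
    abel
  have hwd : (G.plus A).wd = (1 + G.wv * A') * G.wd := by
    simp only [plus, Matrix.mul_assoc, h.eq_mul_inv, Matrix.add_mul,
      Matrix.one_mul]
  have hwu : (G.plus A).wu = (1 + G.wv * A') * G.wu := by
    simp only [plus, Matrix.mul_assoc, h.eq_mul_inv, Matrix.add_mul,
      Matrix.one_mul]
  have hzd : (G.plus A).zd = G.zd + G.zv * (A' * G.wd) := by
    simp only [plus, Matrix.mul_assoc, h.eq_mul_inv]
  have hzu : (G.plus A).zu = G.zu + G.zv * (A' * G.wu) := by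
    simp only [plus, Matrix.mul_assoc, h.eq_mul_inv]
  have hTz : (G.plus A).hatTzd Khat =
      (G.plus A).zd + (G.plus A).zu * (Qhat * (G.plus A).ywd) := by
    rw [hatTzd, Matrix.mul_assoc _ Khat, hQ.eq_mul_inv, Matrix.mul_assoc]
  have hTw : (G.plus A).hatTwd Khat =
      (1 + G.wv * A') * (G.wd + G.wu * (Qhat * (G.plus A).ywd)) := by
    rw [hatTwd, Matrix.mul_assoc _ Khat, hQ.eq_mul_inv, hwd, hwu, Matrix.mul_add]
    simp only [Matrix.mul_assoc]
  have hΔ : G.zv * (1 - E * G.wv)⁻¹ * (E - A) * (G.plus A).hatTwd Khat =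
      G.zv * ((E' - A') * (G.wd + G.wu * (Qhat * (G.plus A).ywd))) := by
    rw [hTw, ← hdiff]
    simp only [Matrix.mul_assoc]
  rw [Matrix.mul_assoc _ _ G.measured.yd, Matrix.mul_assoc _ _ G.measured.yd] at *
  rw [hyd, hΔ, hTz, hzd, hzu]
  change G.zd + (G.zv * E' * G.wd + (G.zu + G.zv * E' * G.wu) * _) = _
  simp only [Matrix.mul_add, Matrix.add_mul, Matrix.sub_mul, Matrix.mul_sub, Matrix.mul_assoc]
  abel

end Plus

end Subsystem

end RetrofitControl

end

theorem theorem1 {W Z Y V D U : Type*}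
    [Fintype W] [DecidableEq W] [Fintype Z] [DecidableEq Z] [Fintype Y] [DecidableEq Y]
    [Fintype V] [DecidableEq V] [Fintype D] [DecidableEq D] [Fintype U] [DecidableEq U]
    (G : RetrofitControl.Subsystem W Z Y V D U)
    (hG : RetrofitControl.IsRHInf G.toMatrix)
    (Gapx : Matrix V W RetrofitControl.TF)
    (hapx : G.IsAdmissible Gapx) :
    -- `X` lies in `RH∞` and is invertible; its inverse lies in `RH∞` if `Gapx` is stable
    (RetrofitControl.IsRHInf (G.xMatrix Gapx) ∧ IsUnit (G.xMatrix Gapx) ∧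
      (RetrofitControl.IsRHInf Gapx → RetrofitControl.IsRHInf (G.xMatrix Gapx)⁻¹)) ∧
    -- sufficiency, for every admissible `Gapx`
    (∀ Khat : Matrix U (Y ⊕ W) RetrofitControl.TF,
      RetrofitControl.IsStabilizing (G.plus Gapx).ywu Khat →
        G.measured.IsOutputRectifying (Khat * G.xMatrix Gapx * G.rectifier)) ∧
    -- the equivalence, when `X` is invertible in `RH∞`
    (RetrofitControl.IsRHInf (G.xMatrix Gapx)⁻¹ →
      ∀ K : Matrix U (Y ⊕ (W ⊕ V)) RetrofitControl.TF,
        G.measured.IsOutputRectifying K ↔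
          ∃ Khat : Matrix U (Y ⊕ W) RetrofitControl.TF,
            RetrofitControl.IsStabilizing (G.plus Gapx).ywu Khat ∧
              K = Khat * G.xMatrix Gapx * G.rectifier) ∧
    -- the closed-loop map, for every environment whose loop with `G` is solvable
    (∀ Khat : Matrix U (Y ⊕ W) RetrofitControl.TF,
      RetrofitControl.IsStabilizing (G.plus Gapx).ywu Khat →
        ∀ Gbar : Matrix V W RetrofitControl.TF, RetrofitControl.IsProper Gbar →
          IsUnit (1 - G.wv * Gbar) →
          IsUnit (1 - G.measured.toMatrix *
            G.measured.link Gbar (Khat * G.xMatrix Gapx * G.rectifier)) ∧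
          G.measured.closedLoop Gbar (Khat * G.xMatrix Gapx * G.rectifier) =
            (G.plus Gapx).hatTzd Khat +
              G.zv * (1 - Gbar * G.wv)⁻¹ * (Gbar - Gapx) * (G.plus Gapx).hatTwd Khat) := by
  obtain ⟨A', hA', h⟩ := hapx.exists_youlaParameter hG
  have hinv := G.xMatrix_mul h
  refine ⟨⟨RetrofitControl.Subsystem.isRHInf_xMatrix hG h hA',
      ⟨⟨_, _, hinv, mul_eq_one_comm.1 hinv⟩, rfl⟩, fun hA => ?_⟩, fun Khat hK =>
      RetrofitControl.Subsystem.isOutputRectifying_of_isStabilizing hG h hA' hK,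
    fun hX K => ⟨RetrofitControl.Subsystem.exists_isStabilizing_of_isOutputRectifying hG h hA' hX,
      ?_⟩, fun Khat hK E _ hE => ?_⟩
  · rw [Matrix.inv_eq_right_inv hinv]
    obtain ⟨⟨hwv, -⟩, -, hyv, -⟩ := RetrofitControl.entriesIn_subsystem
      (RetrofitControl.isRHInf_iff_entriesIn.1 hG)
    rw [RetrofitControl.isRHInf_iff_entriesIn] at *
    exact .fromBlocks .one (hyv.mul hA).neg .zero (.sub .one (hwv.mul hA))
  · rintro ⟨Khat, hK, rfl⟩
    exact RetrofitControl.Subsystem.isOutputRectifying_of_isStabilizing hG h hA' hK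
  -- Stabilization enters only through the existence of the parameter of `Khat`; its stability is
  -- discarded.
  · obtain ⟨Qhat, -, hQ⟩ := (RetrofitControl.internallyStable_iff
      (RetrofitControl.Subsystem.isRHInf_plus_ywu hG h hA')).1 hK.2
    exact RetrofitControl.Subsystem.closedLoop_rectified h hQ hE
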